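/- Let $L\ge 1$ and let $X_1,\dots,X_L$ be independent real random variables such that $X_i$ follows the Pearson type III distribution with parameters $(a_i,b_i,m_i)$, where $a_i$ is a positive integer, $b_i,m_i\in\mathbb R$, and either $b_i>0$ for all $i$ or $b_i<0$ for all $i$. That is, $X_i$ has density $\frac{|b_i|}{\Gamma(a_i)}\,(b_i(x-m_i))^{a_i-1}e^{-b_i(x-m_i)}$ on $(m_i,\infty)$ if $b_i>0$, on $(-\infty,m_i)$ if $b_i<0$, and $0$ elsewhere. Put $SX_L=\sum_{i=1}^L X_i$, $SY_L=e^{SX_L}$, $sa_L=\sum_i a_i$, $sm_L=\sum_i m_i$. For $a>0$, $b\ne0$, $m\in\mathbb R$ let the log Pearson type III range be $(e^m,\infty)$ if $b>0$ and $(0,e^m)$ if $b<0$. For $y$ in this range put $$f_Y(y,a,b,m)=\frac{|b|e^{bm}}{\Gamma(a)}(b(\ln y-m))^{a-1}y^{-b-1},\qquad F_Y(y,a,b,m)=\begin{cases}\frac{1}{\Gamma(a)}\gamma(a,b(\ln y-m)),& b>0,\\ \frac1{\Gamma(a)}\Gamma(a,b(\ln y-m)),& b<0,\end{cases}$$ where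 $\gamma(s,x)=\int_0^x t^{s-1}e^{-t}dt$ and $\Gamma(s,x)=\int_x^\infty t^{s-1}e^{-t}dt$. Outside the range $f_Y=0$, while $F_Y=0$ to the left of the range and $F_Y=1$ to the right of it. Put also $$\mu_Y^n(a,b,m)=e^{mn}\Big(\frac{b}{b-n}\Big)^a .$$ For pairwise distinct rates $b_1,\dots,b_L$, $1\le i\le L$ and $1\le k\le a_i$, let $w_1<\dots<w_{L-1}$ be the elements of $\{1,\dots,L\}\setminus\{i\}$ and define $$\Xi_L^0(i,k)=\sum_{a_i=j_0\ge j_1\ge\cdots\ge j_{L-2}\ge j_{L-1}=k}(-1)^{sa_L-a_i}\,\frac{\prod_{w=1}^L b_w^{a_w}}{b_i^k}\prod_{s=1}^{L-1}\frac{(j_{s-1}+a_{w_s}-j_s-1)!}{(a_{w_s}-1)!\,(j_{s-1}-j_s)!}\,(b_i-b_{w_s})^{j_s-j_{s-1}-a_{w_s}},$$ the sum being over integers $j_1,\dots,j_{L-2}$. (For $L=2$ it has a single term. For $L=1$ the condition reads $a_i=j_0=k$, so that $\Xi_1^0(1,k)$ is $1$ if $k=a_1$ and $0$ otherwise.) Then,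 for every integer $n\ge 0$, the $n$-th moment of $SY_L$ is finite if all $b_i<0$; if all $b_i>0$, it is finite if and only if $b_i>n$ for all $i$. Moreover: 1. If $b_i=b$ for all $i$, then the CDF of $SY_L$ is $F_{SY_L}(y)=F_Y(y,sa_L,b,sm_L)$ for all $y\in\mathbb R$, the function $f_Y(\cdot,sa_L,b,sm_L)$ is a PDF of $SY_L$, and $E[SY_L^n]=\mu_Y^n(sa_L,b,sm_L)$ for every integer $n\ge0$ such that $b<0$ or $b>n$. 2. If $b_i\neq b_j$ for all $i\neq j$, then $$F_{SY_L}(y)=\sum_{i=1}^L\sum_{k=1}^{a_i}\Xi_L^0(i,k)\,F_Y(y,k,b_i,sm_L)\quad\text{for all }y\in\mathbb R,$$ the function $y\mapsto\sum_{i=1}^L\sum_{k=1}^{a_i}\Xi_L^0(i,k)\,f_Y(y,k,b_i,sm_L)$ is nonnegative and is a PDF of $SY_L$, and $$E[SY_L^n]=\sum_{i=1}^L\sum_{k=1}^{a_i}\Xi_L^0(i,k)\,\mu_Y^n(k,b_i,sm_L)$$ for every integer $n\ge0$ such that all $b_i<0$ or all $b_i>n$. -/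

import Mathlib

open MeasureTheory ProbabilityTheory

noncomputable section

/-- The lower incomplete gamma function `γ(s, x) = ∫₀ˣ t ^ (s - 1) e ^ (-t) dt`. -/
def lowerIncGamma (s x : ℝ) : ℝ :=
  ∫ t in Set.Ioc 0 x, t ^ (s - 1) * Real.exp (-t)

/-- The upper incomplete gamma function `Γ(s, x) = ∫ₓ^∞ t ^ (s - 1) e ^ (-t) dt`. -/
def upperIncGamma (s x : ℝ) : ℝ :=
  ∫ t in Set.Ioi x, t ^ (s - 1) * Real.exp (-t)

/-- The range of a Pearson type III variable: `(m, ∞)` if `b > 0`, `(-∞, m)` if `b < 0`. -/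
def pearsonIIIRange (b m : ℝ) : Set ℝ :=
  if 0 < b then Set.Ioi m else Set.Iio m

/-- The Pearson type III density with shape `a`, inverse scale `b` and shift `m`
(zero outside the range). -/
def pearsonIIIPDF (a b m : ℝ) : ℝ → ℝ :=
  (pearsonIIIRange b m).indicator fun x =>
    |b| / Real.Gamma a * (b * (x - m)) ^ (a - 1) * Real.exp (-(b * (x - m)))

/-- The Pearson type III distribution (meant for `0 < a` and `b ≠ 0`). -/
def pearsonIIIMeasure (a b m : ℝ) : Measure ℝ :=
  volume.withDensity fun x => ENNReal.ofReal (pearsonIIIPDF a b m x)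

/-- The range of a log Pearson type III variable:
`(e ^ m, ∞)` if `b > 0`, `(0, e ^ m)` if `b < 0`. -/
def logPearsonIIIRange (b m : ℝ) : Set ℝ :=
  if 0 < b then Set.Ioi (Real.exp m) else Set.Ioo 0 (Real.exp m)

/-- The log Pearson type III density `f_Y(y, a, b, m)` (zero outside the range). -/
def logPearsonIIIPDF (a b m : ℝ) : ℝ → ℝ :=
  (logPearsonIIIRange b m).indicator fun y =>
    |b| * Real.exp (b * m) / Real.Gamma a * (b * (Real.log y - m)) ^ (a - 1) * y ^ (-b - 1)

open Classical in
/-- The log Pearson type III distribution function `F_Y(y, a, b, m)`: the incomplete gamma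
expressions on the range, `0` to the left of the range and `1` to the right of it. -/
def logPearsonIIICDF (a b m y : ℝ) : ℝ :=
  if y ∈ logPearsonIIIRange b m then
    if 0 < b then lowerIncGamma a (b * (Real.log y - m)) / Real.Gamma a
    else upperIncGamma a (b * (Real.log y - m)) / Real.Gamma a
  else if 0 < b then 0
  else if y ≤ 0 then 0 else 1

/-- The closed form `e ^ (m n) (b / (b - n)) ^ a` of the `n`-th log Pearson type III moment
(for `b < 0` or `b > n`). -/
def logPearsonIIIMoment (n : ℕ) (a b m : ℝ) : ℝ :=
  Real.exp (m * n) * (b / (b - n)) ^ a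

/-- `f` is a probability density function of the real random variable `Z`. -/
structure IsDensityOf {Ω : Type*} [MeasurableSpace Ω] (f : ℝ → ℝ) (Z : Ω → ℝ) (P : Measure Ω) :
    Prop where
  measurable : Measurable f
  nonneg : ∀ y, 0 ≤ f y
  hasLaw : HasLaw Z (volume.withDensity fun y => ENNReal.ofReal (f y)) P

/-- The summation indices of the nested sum
`∑_{j₁ = k}^{A} ∑_{j₂ = k}^{j₁} ⋯ ∑_{j_{L-2} = k}^{j_{L-3}}` for `L = N + 1`, completed by the
boundary values `j₀ = A` and `j_{L-1} = k`: the chains `A = j₀ ≥ j₁ ≥ ⋯ ≥ j_N = k`. -/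
def xiChains (N A k : ℕ) : Finset (Fin (N + 1) → ℕ) :=
  (Fintype.piFinset fun _ => Finset.Icc k A).filter fun j =>
    j 0 = A ∧ j (Fin.last N) = k ∧ ∀ s : Fin N, j s.succ ≤ j s.castSucc

/-- The weights `Ξ_L⁰(i, k, {a_q}, {b_q})` for `L = N + 1` summands. With the boundary values
`j₀ = a_i`, `j_{L-1} = k`, the first, the last and the middle factors of each summand all have the
same form. The index `i.succAbove s` runs through the indices different from `i` in increasing
order; it is `s + U(s - i)` in the notation with the Heaviside step function `U`. -/
def Xi0 {N : ℕ} (i : Fin (N + 1)) (k : ℕ) (a : Fin (N + 1) → ℕ) (b : Fin (N + 1) → ℝ) : ℝ :=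
  ∑ j ∈ xiChains N (a i) k,
    (-1) ^ ((∑ q, a q) - a i) * ((∏ w, b w ^ a w) / b i ^ k) *
      ∏ s : Fin N,
        (((j s.castSucc + a (i.succAbove s) - j s.succ - 1).factorial : ℝ) /
            ((a (i.succAbove s) - 1).factorial * (j s.castSucc - j s.succ).factorial)) *
          (b i - b (i.succAbove s)) ^
            ((j s.succ : ℤ) - (j s.castSucc : ℤ) - (a (i.succAbove s) : ℤ))

end

/-! For integer shapes, a Pearson type III law has characteristic function `(b / (b - it)) ^ a * exp
(itm)`, so that of the sum is `∏ (b_i / (b_i - it)) ^ a_i` times `exp (it * ∑ m_i)`. If the rates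
agree, this is again of Pearson type III. If they are distinct, expand the product in partial
fractions in `z = it`: with `X = b_i - z`, the other denominators are `(X - (b_i - b_w)) ^ a_w`.
Their inverses are power series, and the nested sum `Xi0` is, up to normalisation, the coefficient
of `X ^ (a_i - k)` in the product of these series (`Xi0_eq_coeff`, `prod_div_sub_pow_eq_sum_Xi0`).

The law of the sum thus has the same characteristic function as a signed combination of Pearson
laws. Moving the negative weights to the other side leaves two finite positive measures, to which
uniqueness applies (`measureReal_eq_sum_of_charFun`). Pushing forward by `exp` gives the CDF and the
density; nonnegativity is first almost everywhere, then everywhere by continuity on the common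
range.

Moments need no density: by independence they are products of one-variable moments, and the same
partial fraction identity, now over `ℝ` at `z = n`, expands the product. Finiteness reduces to the
factors because these are independent and positive. -/

/-! ### Sums over chains as power series coefficients -/

theorem mem_xiChains {N A k : ℕ} {j : Fin (N + 1) → ℕ} :
    j ∈ xiChains N A k ↔ j 0 = A ∧ j (Fin.last N) = k ∧ ∀ s : Fin N, j s.succ ≤ j s.castSucc := by
  simp only [xiChains, Finset.mem_filter, Fintype.mem_piFinset, Finset.mem_Icc,
    and_iff_right_iff_imp]
  rintro ⟨h0, h1, h2⟩ s
  have : Antitone j := Fin.antitone_iff_succ_le.2 h2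
  exact ⟨h1 ▸ this (Fin.le_last s), h0 ▸ this (Fin.zero_le s)⟩

theorem cons_mem_xiChains {N A k : ℕ} {j : Fin (N + 1) → ℕ} :
    (Fin.cons A j : Fin (N + 2) → ℕ) ∈ xiChains (N + 1) A k ↔
      j 0 ≤ A ∧ j ∈ xiChains N (j 0) k := by
  simp only [mem_xiChains, Fin.cons_zero, true_and, Fin.forall_fin_succ (n := N),
    Fin.castSucc_zero, ← Fin.succ_last, Fin.cons_succ, ← Fin.succ_castSucc]
  tauto

theorem le_of_mem_xiChains {N A k : ℕ} {j : Fin (N + 1) → ℕ} (h : j ∈ xiChains N A k) :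
    k ≤ A := by
  rw [mem_xiChains] at h
  have : Antitone j := Fin.antitone_iff_succ_le.2 h.2.2
  rw [← h.1, ← h.2.1]
  exact this (Fin.zero_le _)

/-- Removing the first entry `A` leaves a chain that starts at some `B` between `k` and `A`. This
recursion mirrors the Cauchy product with one further power series. -/
theorem sum_xiChains_succ {M : Type*} [AddCommMonoid M] (N A k : ℕ)
    (F : (Fin (N + 2) → ℕ) → M) :
    ∑ j ∈ xiChains (N + 1) A k, F j =
      ∑ B ∈ Finset.Icc k A, ∑ j ∈ xiChains N B k, F (Fin.cons A j) := by
  rw [Finset.sum_sigma']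
  refine (Finset.sum_bij' (fun x _ => Fin.cons A x.2) (fun j _ => ⟨j 1, Fin.tail j⟩)
    ?_ ?_ ?_ ?_ ?_).symm
  · rintro ⟨B, j⟩ h
    simp only [Finset.mem_sigma, Finset.mem_Icc] at h
    have h0 := (mem_xiChains.1 h.2).1
    exact cons_mem_xiChains.2 ⟨h0 ▸ h.1.2, h0.symm ▸ h.2⟩
  · intro j h
    have hA := (mem_xiChains.1 h).1
    rw [← Fin.cons_self_tail j, hA, cons_mem_xiChains] at h
    simp only [Finset.mem_sigma, Finset.mem_Icc]
    exact ⟨⟨le_of_mem_xiChains h.2, h.1⟩, h.2⟩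
  · rintro ⟨B, j⟩ h
    simp only [Finset.mem_sigma, Finset.mem_Icc] at h
    have h0 := (mem_xiChains.1 h.2).1
    subst h0
    rfl
  · intro j h
    have hA := (mem_xiChains.1 h).1
    rw [← hA]
    exact Fin.cons_self_tail j
  · intros
    rfl

theorem sum_Icc_eq_sum_antidiagonal {M : Type*} [AddCommMonoid M] {k A : ℕ} (hk : k ≤ A)
    (F : ℕ → ℕ → M) :
    ∑ B ∈ Finset.Icc k A, F (A - B) (B - k) =
      ∑ p ∈ Finset.HasAntidiagonal.antidiagonal (A - k), F p.1 p.2 := by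
  refine Finset.sum_bij' (fun B _ => (A - B, B - k)) (fun p _ => p.2 + k) ?_ ?_ ?_ ?_ ?_
  · intro B hB
    simp only [Finset.mem_Icc, Finset.HasAntidiagonal.mem_antidiagonal] at *
    omega
  · intro B hB
    simp only [Finset.mem_Icc, Finset.HasAntidiagonal.mem_antidiagonal] at *
    omega
  · intro B hB
    simp only [Finset.mem_Icc] at *
    omega
  · rintro ⟨p, q⟩ hB
    simp only [Finset.HasAntidiagonal.mem_antidiagonal, Prod.mk.injEq] at *
    omega
  · intros
    rfl

/-- The sums over chains are the coefficients of a product of power series. -/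
theorem sum_xiChains_prod {R : Type*} [CommSemiring R] {N : ℕ} (f : Fin N → ℕ → R) {A k : ℕ}
    (hk : k ≤ A) :
    ∑ j ∈ xiChains N A k, ∏ s : Fin N, f s (j s.castSucc - j s.succ) =
      PowerSeries.coeff (A - k) (∏ s, PowerSeries.mk (f s)) := by
  induction N generalizing A with
  | zero =>
    have h (j : Fin 1 → ℕ) : j ∈ xiChains 0 A k ↔ j 0 = A ∧ j 0 = k := by
      simp [mem_xiChains]
    simp only [Finset.univ_eq_empty, Finset.prod_empty, PowerSeries.coeff_one]
    split_ifs with h0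
    · have : xiChains 0 A k = {fun _ => A} := by
        ext j
        rw [h, Finset.mem_singleton, funext_iff, Fin.forall_fin_one]
        omega
      simp [this]
    · have : xiChains 0 A k = ∅ := by
        ext j
        rw [h]
        simp only [Finset.notMem_empty, iff_false]
        omega
      simp [this]
  | succ N ih =>
    -- The first drop `A - B` and the total remaining drop `B - k` add up to `A - k`, which is the
    -- antidiagonal of the Cauchy product.
    rw [sum_xiChains_succ, Fin.prod_univ_succ, PowerSeries.coeff_mul,
      ← sum_Icc_eq_sum_antidiagonal hk (fun p q => PowerSeries.coeff p (PowerSeries.mk (f 0)) *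
        PowerSeries.coeff q (∏ s : Fin N, PowerSeries.mk (f s.succ)))]
    refine Finset.sum_congr rfl fun B hB => ?_
    rw [Finset.mem_Icc] at hB
    rw [← ih (fun s => f s.succ) hB.1, PowerSeries.coeff_mk, Finset.mul_sum]
    refine Finset.sum_congr rfl fun j hj => ?_
    rw [Fin.prod_univ_succ]
    simp only [Fin.castSucc_zero, Fin.cons_zero, Fin.cons_succ, ← Fin.succ_castSucc,
      (mem_xiChains.1 hj).1]

/-- The coefficients of the power series `(X - d)⁻ᵃ`. -/
noncomputable def invSubPowCoeff (d : ℝ) (a n : ℕ) : ℝ :=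
  (-1) ^ a * (((n + a - 1).factorial : ℝ) / ((a - 1).factorial * n.factorial) *
    d ^ (-(n : ℤ) - (a : ℤ)))

/-- Since `X - d = -d * (1 - X / d)`, this is the negative binomial series rescaled by `d⁻¹`. At `a
= 0` the truncated subtraction in `a - 1` would give wrong coefficients. -/
theorem mk_invSubPowCoeff_mul {d : ℝ} (hd : d ≠ 0) {a : ℕ} (ha : 0 < a) :
    PowerSeries.mk (invSubPowCoeff d a) * (PowerSeries.X - PowerSeries.C d) ^ a = 1 := by
  obtain ⟨c, rfl⟩ := Nat.exists_eq_add_of_le' ha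
  have h := congrArg (PowerSeries.rescale d⁻¹) (PowerSeries.mk_add_choose_mul_one_sub_pow_eq_one ℝ c)
  have h1 : PowerSeries.mk (invSubPowCoeff d (c + 1)) =
      PowerSeries.C ((-d)⁻¹ ^ (c + 1)) *
        PowerSeries.rescale d⁻¹ (PowerSeries.mk fun n => ((c + n).choose c : ℝ)) := by
    ext n
    rw [PowerSeries.coeff_C_mul, PowerSeries.coeff_rescale, PowerSeries.coeff_mk,
      PowerSeries.coeff_mk, invSubPowCoeff, Nat.cast_add_choose, zpow_sub₀ hd, zpow_neg,
      zpow_natCast, zpow_natCast, inv_pow, inv_pow, neg_pow d, mul_inv, ← inv_pow (-1 : ℝ)]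
    have : n + (c + 1) - 1 = c + n := by omega
    rw [this, Nat.add_sub_cancel, inv_neg_one]
    ring
  have h2 : (PowerSeries.X - PowerSeries.C d : PowerSeries ℝ) =
      PowerSeries.C (-d) * PowerSeries.rescale d⁻¹ (1 - PowerSeries.X) := by
    rw [map_sub, map_one, PowerSeries.rescale_X, mul_sub, ← mul_assoc, ← map_mul]
    simp [hd]
    ring
  rw [h1, h2, mul_pow, ← map_pow, mul_mul_mul_comm, ← map_mul, ← mul_pow,
    inv_mul_cancel₀ (neg_ne_zero.2 hd), ← map_pow, ← map_mul, h]
  simp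

/-- The weights `Ξ⁰` as coefficients of a power series. -/
theorem Xi0_eq_coeff {N : ℕ} (a : Fin (N + 1) → ℕ) (b : Fin (N + 1) → ℝ) (i : Fin (N + 1)) {k : ℕ}
    (hk : k ≤ a i) (ha : ∀ i, 0 < a i) :
    Xi0 i k a b = (∏ w, b w ^ a w) / b i ^ k *
      PowerSeries.coeff (a i - k) (∏ s : Fin N,
        PowerSeries.mk (invSubPowCoeff (b i - b (i.succAbove s)) (a (i.succAbove s)))) := by
  rw [← sum_xiChains_prod _ hk, Finset.mul_sum, Xi0]
  refine Finset.sum_congr rfl fun j hj => ?_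
  have hs : (∑ q, a q) - a i = ∑ s : Fin N, a (i.succAbove s) := by
    rw [Fin.sum_univ_succAbove _ i, Nat.add_sub_cancel_left]
  rw [hs, ← Finset.prod_pow_eq_pow_sum, mul_right_comm, mul_comm, mul_comm (Finset.prod _ _),
    mul_comm (Finset.prod _ _), ← Finset.prod_mul_distrib]
  refine congrArg₂ _ rfl (Finset.prod_congr rfl fun s _ => ?_)
  have h := (mem_xiChains.1 hj).2.2 s
  have h' := ha (i.succAbove s)
  have h1 : j s.castSucc + a (i.succAbove s) - j s.succ - 1 =
      j s.castSucc - j s.succ + a (i.succAbove s) - 1 := by omega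
  have h2 : (j s.succ : ℤ) - j s.castSucc - a (i.succAbove s) =
      -((j s.castSucc - j s.succ : ℕ) : ℤ) - a (i.succAbove s) := by
    push_cast [h]
    ring
  rw [invSubPowCoeff, h1, h2, mul_comm]

/-! ### The partial fraction decomposition -/

open Polynomial in
/-- Truncations of the inverse of a polynomial as a power series. -/
theorem X_pow_dvd_trunc_mul_sub_one {R : Type*} [CommRing R] {g : PowerSeries R} {p : R[X]}
    (h : g * p = 1) (n : ℕ) : X ^ n ∣ PowerSeries.trunc n g * p - 1 := by
  rw [Polynomial.X_pow_dvd_iff]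
  intro d hd
  have h1 := congrArg (PowerSeries.coeff d) h
  rw [← Polynomial.coeff_coe, Polynomial.coe_sub, Polynomial.coe_mul, Polynomial.coe_one, map_sub,
    ← h1, PowerSeries.coeff_mul_eq_coeff_trunc_mul_trunc g p hd,
    PowerSeries.coeff_mul_eq_coeff_trunc_mul_trunc _ (p : PowerSeries R) hd,
    PowerSeries.trunc_trunc, sub_self]

open Polynomial in
/-- The numerators in the partial fraction decomposition of `∏ w, (b w - X) ^ (- a w)`. -/
noncomputable def partialFractionNumerator {N : ℕ} (a : Fin (N + 1) → ℕ) (b : Fin (N + 1) → ℝ)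
    (i : Fin (N + 1)) : ℝ[X] :=
  (PowerSeries.trunc (a i) (∏ s : Fin N, PowerSeries.mk
    (invSubPowCoeff (b i - b (i.succAbove s)) (a (i.succAbove s))))).comp (C (b i) - X)

open Polynomial in
theorem natDegree_C_sub_X (c : ℝ) : (C c - X : ℝ[X]).natDegree = 1 := by
  rw [← neg_sub, natDegree_neg, natDegree_X_sub_C]

open Polynomial in
-- The numerator is a truncated power series inverse of the other factors in the local variable `b i
-- - X`, so the product is `1` up to order `a i` at `b i`.
theorem pow_dvd_partialFractionNumerator_mul_sub_one {N : ℕ} {a : Fin (N + 1) → ℕ}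
    {b : Fin (N + 1) → ℝ} (ha : ∀ i, 0 < a i) (hb : Function.Injective b) (i : Fin (N + 1)) :
    (C (b i) - X) ^ a i ∣ partialFractionNumerator a b i *
      ∏ s : Fin N, (C (b (i.succAbove s)) - X) ^ a (i.succAbove s) - 1 := by
  have h : (∏ s : Fin N, PowerSeries.mk
      (invSubPowCoeff (b i - b (i.succAbove s)) (a (i.succAbove s)))) *
      ((∏ s : Fin N, (X - C (b i - b (i.succAbove s))) ^ a (i.succAbove s) : ℝ[X]) :
        PowerSeries ℝ) = 1 := by
    rw [← Polynomial.coeToPowerSeries.ringHom_apply, map_prod, ← Finset.prod_mul_distrib]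
    refine Finset.prod_eq_one fun s _ => ?_
    rw [Polynomial.coeToPowerSeries.ringHom_apply, Polynomial.coe_pow, Polynomial.coe_sub,
      Polynomial.coe_X, Polynomial.coe_C]
    exact mk_invSubPowCoeff_mul
      (sub_ne_zero.2 fun h => (Fin.succAbove_ne i s) (hb h).symm) (ha _)
  obtain ⟨q, hq⟩ := X_pow_dvd_trunc_mul_sub_one h (a i)
  refine ⟨q.comp (C (b i) - X), ?_⟩
  have h2 := congrArg (fun p : ℝ[X] => p.comp (C (b i) - X)) hq
  simp only [sub_comp, mul_comp, one_comp, pow_comp, X_comp, prod_comp, C_comp] at h2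
  rw [← h2, partialFractionNumerator]
  congr 3
  ext s
  rw [C_sub]
  congr 2
  ring

open Polynomial in
theorem natDegree_partialFractionNumerator_lt {N : ℕ} {a : Fin (N + 1) → ℕ}
    (b : Fin (N + 1) → ℝ) (ha : ∀ i, 0 < a i) (i : Fin (N + 1)) :
    (partialFractionNumerator a b i).natDegree < a i := by
  rw [partialFractionNumerator, natDegree_comp, natDegree_C_sub_X, mul_one]
  obtain ⟨c, hc⟩ := Nat.exists_eq_add_of_le' (ha i)
  rw [hc]
  exact PowerSeries.natDegree_trunc_lt _ _

open Polynomial in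
-- Modulo `(b i - X) ^ a i` the `i`-th summand is `1` and all others vanish. By coprimality the
-- difference of the two sides is divisible by a polynomial of degree `∑ i, a i`, which exceeds its
-- own degree.
theorem sum_partialFractionNumerator_mul {N : ℕ} {a : Fin (N + 1) → ℕ}
    {b : Fin (N + 1) → ℝ} (ha : ∀ i, 0 < a i) (hb : Function.Injective b) :
    ∑ i, partialFractionNumerator a b i *
      ∏ s : Fin N, (C (b (i.succAbove s)) - X) ^ a (i.succAbove s) = 1 := by
  have hne (i) : (C (b i) - X : ℝ[X]) ^ a i ≠ 0 :=
    pow_ne_zero _ (ne_zero_of_natDegree_gt (n := 0) (by rw [natDegree_C_sub_X]; exact one_pos))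
  have hdeg : (∏ i, (C (b i) - X : ℝ[X]) ^ a i).natDegree = ∑ i, a i := by
    rw [natDegree_prod _ _ fun i _ => hne i]
    simp [natDegree_pow, natDegree_C_sub_X]
  have hpos : 0 < ∑ i, a i := Finset.sum_pos (fun i _ => ha i) Finset.univ_nonempty
  rw [← sub_eq_zero]
  refine Polynomial.eq_zero_of_dvd_of_natDegree_lt (p := ∏ i, (C (b i) - X : ℝ[X]) ^ a i) ?_ ?_
  · refine Finset.prod_dvd_of_coprime (fun i _ j _ hij => ?_) fun i _ => ?_
    · refine IsCoprime.pow ?_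
      have h := (pairwise_coprime_X_sub_C hb hij).neg_neg
      simpa only [neg_sub] using h
    · rw [Fin.sum_univ_succAbove _ i, add_sub_right_comm]
      refine dvd_add (pow_dvd_partialFractionNumerator_mul_sub_one ha hb i)
        (Finset.dvd_sum fun t _ => Dvd.dvd.mul_left ?_ _)
      obtain ⟨s, hs⟩ := Fin.exists_succAbove_eq (Fin.succAbove_ne i t).symm
      nth_rw 1 2 [← hs]
      exact Finset.dvd_prod_of_mem
        (fun s => (C (b ((i.succAbove t).succAbove s)) - X : ℝ[X]) ^ a ((i.succAbove t).succAbove s))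
        (Finset.mem_univ s)
  · rw [hdeg]
    refine (natDegree_sub_le _ _).trans_lt (max_lt ?_ (by rwa [natDegree_one]))
    refine (natDegree_sum_le_of_forall_le (n := ∑ i, a i - 1) _ _ fun i _ => ?_).trans_lt
      (by omega)
    refine natDegree_mul_le.trans ?_
    have h1 := natDegree_partialFractionNumerator_lt b ha i
    rw [natDegree_prod _ _ fun s _ => hne _, Fin.sum_univ_succAbove a i]
    simp only [natDegree_pow, natDegree_C_sub_X, mul_one]
    omega

open Polynomial in
-- The coefficient of order `l` in the numerator leaves a pole of order `k = a i - l`. The field is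
-- general because both `ℂ` (characteristic functions) and `ℝ` (moments) are needed.
theorem aeval_partialFractionNumerator {K : Type*} [Field K] [Algebra ℝ K] {N : ℕ}
    {a : Fin (N + 1) → ℕ} {b : Fin (N + 1) → ℝ} (ha : ∀ i, 0 < a i) (hb : ∀ i, b i ≠ 0)
    (i : Fin (N + 1)) {z : K} (hz : algebraMap ℝ K (b i) ≠ z) :
    (∏ w, algebraMap ℝ K (b w) ^ a w) / (algebraMap ℝ K (b i) - z) ^ a i *
      aeval z (partialFractionNumerator a b i) =
    ∑ k ∈ Finset.Icc 1 (a i), algebraMap ℝ K (Xi0 i k a b) *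
      (algebraMap ℝ K (b i) / (algebraMap ℝ K (b i) - z)) ^ k := by
  rw [partialFractionNumerator, aeval_comp, map_sub, aeval_C, aeval_X, aeval_def,
    PowerSeries.eval₂_trunc_eq_sum_range, Finset.mul_sum]
  have hz' := sub_ne_zero.2 hz
  have hb' : algebraMap ℝ K (b i) ≠ 0 := by simpa using hb i
  refine Finset.sum_bij' (fun l _ => a i - l) (fun k _ => a i - k) ?_ ?_ ?_ ?_ ?_
  · intro l hl
    simp only [Finset.mem_range, Finset.mem_Icc] at *
    omega
  · intro l hl
    have := ha i
    simp only [Finset.mem_range, Finset.mem_Icc] at *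
    omega
  · intro l hl
    simp only [Finset.mem_range] at *
    omega
  · intro l hl
    simp only [Finset.mem_Icc] at *
    omega
  · intro l hl
    rw [Finset.mem_range] at hl
    rw [Xi0_eq_coeff a b i (Nat.sub_le _ _) ha, Nat.sub_sub_self hl.le, map_mul, map_div₀,
      map_prod (algebraMap ℝ K)]
    simp_rw [map_pow]
    rw [div_pow, pow_sub₀ _ hz' hl.le]
    field_simp

/-- The partial fraction decomposition behind the weights `Ξ⁰`. -/
theorem prod_div_sub_pow_eq_sum_Xi0 {K : Type*} [Field K] [Algebra ℝ K] {N : ℕ}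
    {a : Fin (N + 1) → ℕ} {b : Fin (N + 1) → ℝ} (ha : ∀ i, 0 < a i) (hb : ∀ i, b i ≠ 0)
    (hinj : Function.Injective b) {z : K} (hz : ∀ i, algebraMap ℝ K (b i) ≠ z) :
    ∏ i, (algebraMap ℝ K (b i) / (algebraMap ℝ K (b i) - z)) ^ a i =
      ∑ i, ∑ k ∈ Finset.Icc 1 (a i), algebraMap ℝ K (Xi0 i k a b) *
        (algebraMap ℝ K (b i) / (algebraMap ℝ K (b i) - z)) ^ k := by
  simp_rw [← aeval_partialFractionNumerator ha hb _ (hz _)]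
  have h := congrArg (Polynomial.aeval z) (sum_partialFractionNumerator_mul ha hinj)
  simp only [map_sum, map_mul, map_prod, map_pow, map_sub, Polynomial.aeval_C, Polynomial.aeval_X,
    map_one] at h
  simp_rw [div_pow]
  rw [Finset.prod_div_distrib, ← mul_one (_ / _), ← h, Finset.mul_sum]
  refine Finset.sum_congr rfl fun i _ => ?_
  rw [Fin.prod_univ_succAbove (fun w => (algebraMap ℝ K (b w) - z) ^ a w) i]
  have h1 : ∏ s : Fin N, (algebraMap ℝ K (b (i.succAbove s)) - z) ^ a (i.succAbove s) ≠ 0 :=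
    Finset.prod_ne_zero_iff.2 fun s _ => pow_ne_zero _ (sub_ne_zero.2 (hz _))
  have h2 := sub_ne_zero.2 (hz i)
  field_simp

/-! ### The standard gamma distribution -/

theorem gammaMeasure_one_eq (a : ℝ) :
    gammaMeasure a 1 = (volume.restrict (Set.Ioi 0)).withDensity
      fun t => ENNReal.ofReal (t ^ (a - 1) * Real.exp (-t) / Real.Gamma a) := by
  rw [gammaMeasure, ← withDensity_indicator measurableSet_Ioi]
  refine withDensity_congr_ae ?_
  filter_upwards [compl_mem_ae_iff.2 (measure_singleton (0 : ℝ))] with t ht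
  have ht : t ≠ 0 := ht
  rcases lt_or_gt_of_ne ht with h | h
  · rw [gammaPDF_of_neg h, Set.indicator_of_notMem (Set.notMem_Ioi.2 h.le)]
  · rw [gammaPDF_of_nonneg h.le, Set.indicator_of_mem (Set.mem_Ioi.2 h), Real.one_rpow, one_mul]
    congr 1
    ring

theorem integral_gammaMeasure_one {E : Type*} [NormedAddCommGroup E] [NormedSpace ℝ E] {a : ℝ}
    (ha : 0 < a) (f : ℝ → E) :
    ∫ t, f t ∂(gammaMeasure a 1) =
      ∫ t in Set.Ioi 0, (t ^ (a - 1) * Real.exp (-t) / Real.Gamma a) • f t := by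
  rw [gammaMeasure_one_eq, integral_withDensity_eq_integral_toReal_smul (by fun_prop) (by simp)]
  refine setIntegral_congr_fun measurableSet_Ioi fun t ht => ?_
  have := Real.Gamma_pos_of_pos ha
  have ht : 0 < t := ht
  rw [ENNReal.toReal_ofReal (by positivity)]

theorem integrable_gammaMeasure_one_iff {E : Type*} [NormedAddCommGroup E] [NormedSpace ℝ E] {a : ℝ}
    (ha : 0 < a) (f : ℝ → E) :
    Integrable f (gammaMeasure a 1) ↔
      IntegrableOn (fun t => (t ^ (a - 1) * Real.exp (-t) / Real.Gamma a) • f t) (Set.Ioi 0) := by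
  rw [gammaMeasure_one_eq, integrable_withDensity_iff_integrable_smul' (by fun_prop) (by simp)]
  refine integrableOn_congr_fun (fun t ht => ?_) measurableSet_Ioi
  have := Real.Gamma_pos_of_pos ha
  have ht : 0 < t := ht
  rw [ENNReal.toReal_ofReal (by positivity)]

theorem integrable_exp_gammaMeasure_one_iff {a : ℝ} (ha : 0 < a) (c : ℝ) :
    Integrable (fun t => Real.exp (c * t)) (gammaMeasure a 1) ↔ c < 1 := by
  have := isProbabilityMeasure_gammaMeasure ha one_pos
  have key (c t : ℝ) : (t ^ (a - 1) * Real.exp (-t) / Real.Gamma a) • Real.exp (c * t) =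
      (Real.Gamma a)⁻¹ * (t ^ (a - 1) * Real.exp (-(1 - c) * t)) := by
    have : Real.exp (-(1 - c) * t) = Real.exp (-t) * Real.exp (c * t) := by
      rw [← Real.exp_add]
      ring_nf
    rw [this, smul_eq_mul]
    ring
  constructor
  · intro h
    by_contra! hc
    -- Integrability for some `c ≥ 1` passes down to `c = 1`, where the exponentials cancel and a
    -- bare power of `t` remains, which is never integrable on `(0, ∞)`.
    have h1 := integrable_exp_mul_of_nonneg_of_le (X := fun t => t) h zero_le_one hc
    rw [integrable_gammaMeasure_one_iff ha] at h1
    simp_rw [key] at h1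
    have h2 := h1.const_mul (Real.Gamma a)
    refine not_integrableOn_Ioi_rpow (a - 1) ?_
    refine (integrable_congr (Filter.Eventually.of_forall fun t => ?_)).1 h2
    have := (Real.Gamma_pos_of_pos ha).ne'
    simp only [sub_self, neg_zero, zero_mul, Real.exp_zero, mul_one]
    field_simp
  · intro hc
    rw [integrable_gammaMeasure_one_iff ha]
    simp_rw [key]
    refine Integrable.const_mul ?_ _
    have h := integrableOn_rpow_mul_exp_neg_mul_rpow (p := 1) (s := a - 1) (b := 1 - c)
      (by linarith) zero_lt_one (by linarith)
    simp only [Real.rpow_one] at h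
    exact h

theorem integral_exp_gammaMeasure_one {a : ℝ} (ha : 0 < a) {c : ℝ} (hc : c < 1) :
    ∫ t, Real.exp (c * t) ∂(gammaMeasure a 1) = (1 / (1 - c)) ^ a := by
  rw [integral_gammaMeasure_one ha]
  have h := Real.integral_rpow_mul_exp_neg_mul_Ioi ha (sub_pos.2 hc)
  have hG := (Real.Gamma_pos_of_pos ha).ne'
  rw [← mul_div_cancel_right₀ ((1 / (1 - c)) ^ a) hG, ← h, div_eq_inv_mul, ← integral_const_mul]
  refine integral_congr_ae (Filter.Eventually.of_forall fun t => ?_)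
  have : Real.exp (-((1 - c) * t)) = Real.exp (-t) * Real.exp (c * t) := by
    rw [← Real.exp_add]
    ring_nf
  dsimp only
  rw [this, smul_eq_mul]
  ring

/-- Integration by parts gives a recursion in `n`; the boundary terms at infinity vanish because `r`
has real part `1`. The characteristic function uses `r = 1 - it`. -/
theorem integral_pow_mul_cexp_Ioi {r : ℂ} (hr : r.re = 1) (n : ℕ) :
    IntegrableOn (fun t : ℝ => (t : ℂ) ^ n * Complex.exp (-(r * t))) (Set.Ioi 0) ∧
    ∫ t : ℝ in Set.Ioi 0, (t : ℂ) ^ n * Complex.exp (-(r * t)) = n.factorial / r ^ (n + 1) := by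
  have hr0 : r ≠ 0 := by
    rintro rfl
    simp at hr
  have hnorm (n : ℕ) (t : ℝ) (ht : 0 ≤ t) :
      ‖(t : ℂ) ^ n * Complex.exp (-(r * t))‖ = t ^ n * Real.exp (-t) := by
    simp [Complex.norm_exp, hr, abs_of_nonneg ht]
  have hint (n : ℕ) :
      IntegrableOn (fun t : ℝ => (t : ℂ) ^ n * Complex.exp (-(r * t))) (Set.Ioi 0) := by
    have h := Real.GammaIntegral_convergent (s := n + 1) (by positivity)
    refine h.mono' (by fun_prop) ((ae_restrict_mem measurableSet_Ioi).mono fun t ht => ?_)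
    rw [hnorm n t (le_of_lt ht), add_sub_cancel_right, Real.rpow_natCast, mul_comm]
  have htend (n : ℕ) : Filter.Tendsto (fun t : ℝ => (t : ℂ) ^ n * Complex.exp (-(r * t)))
      Filter.atTop (nhds 0) := by
    rw [tendsto_zero_iff_norm_tendsto_zero]
    refine (Real.tendsto_pow_mul_exp_neg_atTop_nhds_zero n).congr' ?_
    filter_upwards [Filter.eventually_ge_atTop 0] with t ht
    rw [hnorm n t ht]
  refine ⟨hint n, ?_⟩
  have hexp (t : ℝ) : HasDerivAt (fun t : ℝ => Complex.exp (-(r * t)))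
      (Complex.exp (-(r * t)) * -(r * 1)) t :=
    (((hasDerivAt_id t).ofReal_comp.const_mul r).neg).cexp
  induction n with
  | zero =>
    have h := integral_Ioi_of_hasDerivAt_of_tendsto' (a := 0) (fun t _ => hexp t)
      (by simpa [IntegrableOn] using (hint 0).mul_const (-r)) (by simpa using htend 0)
    rw [integral_mul_const] at h
    simp only [mul_one, Complex.ofReal_zero, mul_zero, neg_zero, Complex.exp_zero] at h
    simp only [pow_zero, one_mul, Nat.factorial_zero, Nat.cast_one, zero_add, pow_one]
    rw [eq_div_iff hr0]
    linear_combination -h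
  | succ n ih =>
    have hd (t : ℝ) : HasDerivAt (fun t : ℝ => (t : ℂ) ^ (n + 1) * Complex.exp (-(r * t)))
        ((n + 1) * ((t : ℂ) ^ n * Complex.exp (-(r * t))) -
          r * ((t : ℂ) ^ (n + 1) * Complex.exp (-(r * t)))) t := by
      have h := ((hasDerivAt_id t).ofReal_comp.pow (n + 1)).mul (hexp t)
      refine h.congr_deriv ?_
      simp
      ring
    have h := integral_Ioi_of_hasDerivAt_of_tendsto' (a := 0) (fun t _ => hd t)
      (((hint n).const_mul _).sub ((hint (n + 1)).const_mul r)) (htend (n + 1))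
    rw [integral_sub ((hint n).const_mul _) ((hint (n + 1)).const_mul r), integral_const_mul,
      integral_const_mul, ih] at h
    simp only [Complex.ofReal_zero, ne_eq, Nat.add_eq_zero_iff, one_ne_zero, and_false,
      not_false_eq_true, zero_pow, zero_mul, sub_zero] at h
    rw [Nat.factorial_succ, eq_div_iff (pow_ne_zero _ hr0)]
    have h2 : (n.factorial : ℂ) = n.factorial / r ^ (n + 1) * r ^ (n + 1) := by field_simp
    push_cast
    rw [h2]
    linear_combination -h * r ^ (n + 1)

theorem charFun_gammaMeasure_one {n : ℕ} (hn : 0 < n) (t : ℝ) :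
    charFun (gammaMeasure n 1) t = (1 / (1 - t * Complex.I)) ^ n := by
  obtain ⟨k, rfl⟩ := Nat.exists_eq_add_of_le' hn
  have h := (integral_pow_mul_cexp_Ioi (r := 1 - t * Complex.I) (by simp) k).2
  have hk : (k.factorial : ℂ) ≠ 0 := by exact_mod_cast k.factorial_ne_zero
  rw [charFun_apply_real, integral_gammaMeasure_one (by positivity), one_div, inv_pow,
    ← mul_inv_cancel_left₀ hk ((1 - t * Complex.I) ^ (k + 1))⁻¹, mul_left_comm, ← div_eq_mul_inv, ← h,
    ← integral_const_mul]
  refine setIntegral_congr_fun measurableSet_Ioi fun x _ => ?_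
  have : Complex.exp (-((1 - t * Complex.I) * x)) =
      Complex.exp (-x) * Complex.exp (t * x * Complex.I) := by
    rw [← Complex.exp_add]
    ring_nf
  rw [this, Nat.cast_succ, add_sub_cancel_right, Real.rpow_natCast, Real.Gamma_nat_eq_factorial,
    Complex.real_smul]
  push_cast
  ring

theorem measureReal_gammaMeasure_one {a : ℝ} (ha : 0 < a) {s : Set ℝ} (hs : MeasurableSet s) :
    (gammaMeasure a 1).real s =
      (∫ t in Set.Ioi 0 ∩ s, t ^ (a - 1) * Real.exp (-t)) / Real.Gamma a := by
  rw [← integral_indicator_one hs, integral_gammaMeasure_one ha,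
    ← integral_div, ← setIntegral_indicator hs]
  refine setIntegral_congr_fun measurableSet_Ioi fun x _ => ?_
  by_cases hx : x ∈ s <;> simp [hx]

theorem gammaMeasure_one_real_Iic {a : ℝ} (ha : 0 < a) (x : ℝ) :
    (gammaMeasure a 1).real (Set.Iic x) = lowerIncGamma a x / Real.Gamma a := by
  rw [measureReal_gammaMeasure_one ha measurableSet_Iic, Set.Ioi_inter_Iic, lowerIncGamma]

/-- For negative `x` the integral in `upperIncGamma` would also run over `(x, 0]`, outside the
support; the lower function has no such restriction, its interval being empty there. -/
theorem gammaMeasure_one_real_Ici {a x : ℝ} (ha : 0 < a) (hx : 0 ≤ x) :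
    (gammaMeasure a 1).real (Set.Ici x) = upperIncGamma a x / Real.Gamma a := by
  have h : (gammaMeasure a 1).real (Set.Ici x) = (gammaMeasure a 1).real (Set.Ioi x) :=
    measureReal_congr (Ioi_ae_eq_Ici' (withDensity_absolutelyContinuous _ _ (by simp))).symm
  rw [h, measureReal_gammaMeasure_one ha measurableSet_Ioi, Set.Ioi_inter_Ioi, sup_of_le_right hx,
    upperIncGamma]

/-! ### The Pearson type III and log Pearson type III distributions -/

theorem isOpen_logPearsonIIIRange (b m : ℝ) : IsOpen (logPearsonIIIRange b m) := by
  unfold logPearsonIIIRange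
  split_ifs
  exacts [isOpen_Ioi, isOpen_Ioo]

theorem pos_of_mem_logPearsonIIIRange {b m y : ℝ} (h : y ∈ logPearsonIIIRange b m) : 0 < y := by
  unfold logPearsonIIIRange at h
  split_ifs at h
  exacts [(Real.exp_pos m).trans h, h.1]

theorem exp_mem_logPearsonIIIRange {b m x : ℝ} :
    Real.exp x ∈ logPearsonIIIRange b m ↔ x ∈ pearsonIIIRange b m := by
  unfold logPearsonIIIRange pearsonIIIRange
  split_ifs <;> simp [Real.exp_pos]

theorem add_div_mem_pearsonIIIRange {b m t : ℝ} (hb : b ≠ 0) :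
    m + t / b ∈ pearsonIIIRange b m ↔ 0 < t := by
  unfold pearsonIIIRange
  split_ifs with h
  · simp [div_pos_iff_of_pos_right h]
  · have h : b < 0 := lt_of_le_of_ne (not_lt.1 h) hb
    simp [div_neg_iff, h, h.not_gt]

theorem mul_pos_of_mem_pearsonIIIRange {b m x : ℝ} (hb : b ≠ 0) (hx : x ∈ pearsonIIIRange b m) :
    0 < b * (x - m) := by
  refine (add_div_mem_pearsonIIIRange (m := m) hb).1 ?_
  rwa [mul_div_cancel_left₀ _ hb, add_sub_cancel]

theorem pearsonIIIPDF_nonneg {a b : ℝ} (ha : 0 < a) (hb : b ≠ 0) (m x : ℝ) :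
    0 ≤ pearsonIIIPDF a b m x := by
  refine Set.indicator_nonneg (fun x hx => ?_) x
  have := mul_pos_of_mem_pearsonIIIRange hb hx
  have := Real.Gamma_pos_of_pos ha
  positivity

/-- The factor `Real.exp x` is the Jacobian of `y = exp x`. Both sides vanish off the range, so the
identity holds for every `x`. -/
theorem exp_mul_logPearsonIIIPDF_exp (a b m x : ℝ) :
    Real.exp x * logPearsonIIIPDF a b m (Real.exp x) = pearsonIIIPDF a b m x := by
  unfold logPearsonIIIPDF pearsonIIIPDF
  by_cases h : x ∈ pearsonIIIRange b m
  · rw [Set.indicator_of_mem h, Set.indicator_of_mem (exp_mem_logPearsonIIIRange.2 h), Real.log_exp,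
      ← Real.exp_mul, div_mul_eq_mul_div, div_mul_eq_mul_div, div_mul_eq_mul_div,
      div_mul_eq_mul_div, mul_div_assoc']
    have : Real.exp (-(b * (x - m))) =
        Real.exp x * Real.exp (b * m) * Real.exp (x * (-b - 1)) := by
      rw [← Real.exp_add, ← Real.exp_add]
      ring_nf
    rw [this]
    ring
  · rw [Set.indicator_of_notMem h, Set.indicator_of_notMem (mt exp_mem_logPearsonIIIRange.1 h),
      mul_zero]

theorem logPearsonIIIPDF_nonneg {a b : ℝ} (ha : 0 < a) (hb : b ≠ 0) (m y : ℝ) :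
    0 ≤ logPearsonIIIPDF a b m y := by
  by_cases hy : y ∈ logPearsonIIIRange b m
  · have h0 := pos_of_mem_logPearsonIIIRange hy
    have h := pearsonIIIPDF_nonneg ha hb m (Real.log y)
    rw [← exp_mul_logPearsonIIIPDF_exp, Real.exp_log h0] at h
    exact nonneg_of_mul_nonneg_right h h0
  · exact (Set.indicator_of_notMem hy _).ge

theorem measurable_logPearsonIIIPDF (a b m : ℝ) : Measurable (logPearsonIIIPDF a b m) :=
  Measurable.indicator (by fun_prop) (isOpen_logPearsonIIIRange b m).measurableSet

theorem continuousOn_logPearsonIIIPDF {a b : ℝ} (hb : b ≠ 0) (m : ℝ) :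
    ContinuousOn (logPearsonIIIPDF a b m) (logPearsonIIIRange b m) := by
  refine ContinuousOn.congr ?_ (Set.eqOn_indicator)
  have h0 (y) (hy : y ∈ logPearsonIIIRange b m) : y ≠ 0 := (pos_of_mem_logPearsonIIIRange hy).ne'
  refine (continuousOn_const.mul (ContinuousOn.rpow_const ?_ fun y hy => Or.inl ?_)).mul
    (continuousOn_id.rpow_const fun y hy => Or.inl (h0 y hy))
  · exact continuousOn_const.mul ((continuousOn_id.log h0).sub continuousOn_const)
  · refine (mul_pos_of_mem_pearsonIIIRange hb (exp_mem_logPearsonIIIRange.1 ?_)).ne'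
    rwa [Real.exp_log (pos_of_mem_logPearsonIIIRange hy)]

/-- The affine map covers both signs of `b` at once and reduces all computations to the standard
gamma law. -/
theorem pearsonIIIMeasure_eq_map {a b : ℝ} (hb : b ≠ 0) (m : ℝ) :
    pearsonIIIMeasure a b m = (gammaMeasure a 1).map fun t => m + t / b := by
  ext s hs
  have hf : Measurable fun t => m + t / b := by fun_prop
  have hinj : Function.Injective fun t => m + t / b := fun x y h => by
    simpa [hb, div_left_inj'] using h
  have hsurj : Function.Surjective fun t => m + t / b := fun x => ⟨b * (x - m), by
    simp only
    field_simp
    ring⟩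
  have hder (x : ℝ) (_ : x ∈ (fun t => m + t / b) ⁻¹' s) :
      HasDerivWithinAt (fun t => m + t / b) (1 / b) ((fun t => m + t / b) ⁻¹' s) x :=
    (((hasDerivAt_id x).div_const b).const_add m).hasDerivWithinAt
  have hcov := lintegral_image_eq_lintegral_abs_deriv_mul (hf hs) hder hinj.injOn
    fun x => ENNReal.ofReal (pearsonIIIPDF a b m x)
  rw [Set.image_preimage_eq s hsurj] at hcov
  rw [Measure.map_apply hf hs, gammaMeasure, withDensity_apply _ (hf hs), pearsonIIIMeasure,
    withDensity_apply _ hs, hcov]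
  refine lintegral_congr_ae (ae_restrict_of_ae ?_)
  filter_upwards [compl_mem_ae_iff.2 (measure_singleton (0 : ℝ))] with t ht
  have ht : t ≠ 0 := ht
  rcases lt_or_gt_of_ne ht with h | h
  · rw [gammaPDF_of_neg h, pearsonIIIPDF,
      Set.indicator_of_notMem (mt (add_div_mem_pearsonIIIRange hb).1 h.not_gt), ENNReal.ofReal_zero,
      mul_zero]
  · rw [gammaPDF_of_nonneg h.le, pearsonIIIPDF,
      Set.indicator_of_mem ((add_div_mem_pearsonIIIRange hb).2 h),
      ← ENNReal.ofReal_mul (abs_nonneg _), add_sub_cancel_left, mul_div_cancel₀ _ hb, abs_div,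
      abs_one, Real.one_rpow, one_mul, ← mul_assoc, ← mul_assoc, mul_div_assoc',
      one_div_mul_cancel (abs_ne_zero.2 hb)]

theorem isProbabilityMeasure_pearsonIIIMeasure {a b : ℝ} (ha : 0 < a) (hb : b ≠ 0) (m : ℝ) :
    IsProbabilityMeasure (pearsonIIIMeasure a b m) := by
  have := isProbabilityMeasure_gammaMeasure ha one_pos
  rw [pearsonIIIMeasure_eq_map hb]
  exact Measure.isProbabilityMeasure_map (by fun_prop)

theorem charFun_pearsonIIIMeasure {n : ℕ} (hn : 0 < n) {b : ℝ} (hb : b ≠ 0) (m t : ℝ) :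
    charFun (pearsonIIIMeasure n b m) t =
      (b / (b - t * Complex.I)) ^ n * Complex.exp (t * m * Complex.I) := by
  have h : (fun t => m + t / b) = (m + ·) ∘ (b⁻¹ * ·) := by
    ext t
    simp [div_eq_inv_mul]
  have hb' : (b : ℂ) ≠ 0 := by exact_mod_cast hb
  rw [pearsonIIIMeasure_eq_map hb, h, ← Measure.map_map (by fun_prop) (by fun_prop),
    charFun_map_const_add, charFun_map_mul, charFun_gammaMeasure_one hn]
  congr 1
  · congr 1
    push_cast
    rw [show (b : ℂ) - t * Complex.I = b * (1 - (b : ℂ)⁻¹ * t * Complex.I) by field_simp, ← div_div,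
      div_self hb']
  · simp

theorem map_exp_pearsonIIIMeasure (a b m : ℝ) :
    (pearsonIIIMeasure a b m).map Real.exp =
      volume.withDensity fun y => ENNReal.ofReal (logPearsonIIIPDF a b m y) := by
  ext s hs
  have hs' := Real.measurable_exp hs
  rw [Measure.map_apply Real.measurable_exp hs, pearsonIIIMeasure, withDensity_apply _ hs',
    withDensity_apply _ hs]
  have h : ∫⁻ y in s, ENNReal.ofReal (logPearsonIIIPDF a b m y) =
      ∫⁻ y in Real.exp '' (Real.exp ⁻¹' s), ENNReal.ofReal (logPearsonIIIPDF a b m y) := by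
    rw [Set.image_preimage_eq_inter_range, Real.range_exp, Set.inter_comm,
      ← setLIntegral_indicator measurableSet_Ioi]
    refine lintegral_congr fun y => ?_
    by_cases hy : 0 < y
    · rw [Set.indicator_of_mem (Set.mem_Ioi.2 hy)]
    · rw [Set.indicator_of_notMem (by simpa using hy), logPearsonIIIPDF,
        Set.indicator_of_notMem (mt pos_of_mem_logPearsonIIIRange hy), ENNReal.ofReal_zero]
  rw [h, lintegral_image_eq_lintegral_abs_deriv_mul hs'
    (fun x _ => (Real.hasDerivAt_exp x).hasDerivWithinAt) Real.exp_injective.injOn]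
  refine lintegral_congr fun x => ?_
  rw [← ENNReal.ofReal_mul (abs_nonneg _), Real.abs_exp, exp_mul_logPearsonIIIPDF_exp]

theorem pearsonIIIMeasure_real_exp_preimage_Iic {a b : ℝ} (ha : 0 < a) (hb : b ≠ 0) (m y : ℝ) :
    (pearsonIIIMeasure a b m).real (Real.exp ⁻¹' Set.Iic y) = logPearsonIIICDF a b m y := by
  have := isProbabilityMeasure_gammaMeasure ha one_pos
  have hm : MeasurableSet (Real.exp ⁻¹' Set.Iic y) := Real.measurable_exp measurableSet_Iic
  rw [pearsonIIIMeasure_eq_map hb, map_measureReal_apply (by fun_prop) hm]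
  rcases le_or_gt y 0 with hy | hy
  · have h1 : y ∉ logPearsonIIIRange b m := fun h => hy.not_gt (pos_of_mem_logPearsonIIIRange h)
    have h2 : Real.exp ⁻¹' Set.Iic y = ∅ := by
      ext x
      simpa using hy.trans_lt (Real.exp_pos x)
    rw [h2, logPearsonIIICDF, if_neg h1]
    simp [hy]
  obtain ⟨x, rfl⟩ : ∃ x, y = Real.exp x := ⟨Real.log y, (Real.exp_log hy).symm⟩
  have h2 : Real.exp ⁻¹' Set.Iic (Real.exp x) = Set.Iic x := by
    ext
    simp
  simp only [logPearsonIIICDF, Real.log_exp, h2, if_neg hy.not_ge]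
  rcases lt_or_gt_of_ne hb with hb0 | hb0
  · have h3 : (fun t => m + t / b) ⁻¹' Set.Iic x = Set.Ici (b * (x - m)) := by
      ext t
      rw [Set.mem_preimage, Set.mem_Iic, Set.mem_Ici, ← le_sub_iff_add_le', div_le_iff_of_neg' hb0]
    simp only [h3, if_neg hb0.not_gt]
    split_ifs with h <;>
      rw [exp_mem_logPearsonIIIRange, pearsonIIIRange, if_neg hb0.not_gt, Set.mem_Iio] at h
    · exact gammaMeasure_one_real_Ici ha (mul_pos_of_neg_of_neg hb0 (sub_neg.2 h)).le
    -- To the right of the range the threshold is nonpositive, so the half-line carries all the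
    -- mass.
    · have h4 : gammaMeasure a 1 (Set.Ici (b * (x - m)))ᶜ = 0 := by
        rw [gammaMeasure_one_eq, withDensity_apply _ measurableSet_Ici.compl,
          Measure.restrict_restrict measurableSet_Ici.compl]
        have : (Set.Ici (b * (x - m)))ᶜ ∩ Set.Ioi 0 = ∅ := by
          ext t
          have := mul_nonpos_of_nonpos_of_nonneg hb0.le (sub_nonneg.2 (not_lt.1 h))
          simp only [Set.compl_Ici, Set.mem_inter_iff, Set.mem_Iio, Set.mem_Ioi,
            Set.mem_empty_iff_false, iff_false]
          intro h
          linarith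
        rw [this, Measure.restrict_empty, lintegral_zero_measure]
      rw [measureReal_def, (prob_compl_eq_zero_iff measurableSet_Ici).1 h4, ENNReal.toReal_one]
  · have h3 : (fun t => m + t / b) ⁻¹' Set.Iic x = Set.Iic (b * (x - m)) := by
      ext t
      rw [Set.mem_preimage, Set.mem_Iic, Set.mem_Iic, ← le_sub_iff_add_le', div_le_iff₀' hb0]
    simp only [h3, if_pos hb0, gammaMeasure_one_real_Iic ha]
    split_ifs with h <;>
      rw [exp_mem_logPearsonIIIRange, pearsonIIIRange, if_pos hb0, Set.mem_Ioi] at h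
    rw [lowerIncGamma, Set.Ioc_eq_empty
      (mul_nonpos_of_nonneg_of_nonpos hb0.le (sub_nonpos.2 (not_lt.1 h))).not_gt]
    simp

theorem exp_mul_add_div (c m t b : ℝ) :
    Real.exp (c * (m + t / b)) = Real.exp (m * c) * Real.exp (c / b * t) := by
  rw [← Real.exp_add]
  ring_nf

theorem div_lt_one_iff_neg_or_lt {b c : ℝ} (hb : b ≠ 0) (hc : 0 ≤ c) :
    c / b < 1 ↔ b < 0 ∨ c < b := by
  rcases lt_or_gt_of_ne hb with h | h
  · simp [h, (div_nonpos_of_nonneg_of_nonpos hc h.le).trans_lt one_pos]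
  · simp [h.not_gt, div_lt_one h]

/-- Under `x = m + t / b` the integrand is a constant times `exp ((n / b) * t)`, so the condition is
`n / b < 1`. -/
theorem integrable_exp_pearsonIIIMeasure_iff {a b : ℝ} (ha : 0 < a) (hb : b ≠ 0) (m : ℝ) (n : ℕ) :
    Integrable (fun x => Real.exp (n * x)) (pearsonIIIMeasure a b m) ↔ b < 0 ∨ (n : ℝ) < b := by
  rw [pearsonIIIMeasure_eq_map hb, integrable_map_measure (by fun_prop) (by fun_prop),
    ← div_lt_one_iff_neg_or_lt hb n.cast_nonneg, ← integrable_exp_gammaMeasure_one_iff ha]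
  simp only [Function.comp_def, exp_mul_add_div]
  exact integrable_const_mul_iff (Ne.isUnit (Real.exp_pos (m * n)).ne') _

theorem integral_exp_pearsonIIIMeasure {a b : ℝ} (ha : 0 < a) (hb : b ≠ 0) (m : ℝ) {n : ℕ}
    (hn : b < 0 ∨ (n : ℝ) < b) :
    ∫ x, Real.exp (n * x) ∂(pearsonIIIMeasure a b m) = logPearsonIIIMoment n a b m := by
  rw [← div_lt_one_iff_neg_or_lt hb n.cast_nonneg] at hn
  rw [pearsonIIIMeasure_eq_map hb, integral_map (by fun_prop) (by fun_prop)]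
  simp only [exp_mul_add_div]
  rw [integral_const_mul, integral_exp_gammaMeasure_one ha hn, logPearsonIIIMoment, one_sub_div hb,
    one_div_div]

/-! ### Integrability of products of independent variables -/

theorem lintegral_prod_of_iIndepFun {Ω ι : Type*} [MeasurableSpace Ω] {P : Measure Ω}
    (s : Finset ι) {Y : ι → Ω → ENNReal} (h : iIndepFun Y P) (hY : ∀ i, AEMeasurable (Y i) P) :
    ∫⁻ ω, ∏ i ∈ s, Y i ω ∂P = ∏ i ∈ s, ∫⁻ ω, Y i ω ∂P := by
  have h1 := lintegral_prod_eq_prod_lintegral_of_indepFun s (fun i => (hY i).mk (Y i))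
    (h.congr fun i => (hY i).ae_eq_mk) fun i => (hY i).measurable_mk
  have h2 : ∀ᵐ ω ∂P, ∀ i ∈ s, Y i ω = (hY i).mk (Y i) ω :=
    (Finset.eventually_all s).2 fun i _ => (hY i).ae_eq_mk
  rw [lintegral_congr_ae (h2.mono fun ω hω => Finset.prod_congr rfl hω), h1]
  exact Finset.prod_congr rfl fun i _ => lintegral_congr_ae (hY i).ae_eq_mk.symm

/-- In `ENNReal` the expectation of the product is the product of the expectations. None of these is
zero, by positivity, so one infinite factor makes the product infinite. -/
theorem integrable_prod_iff_of_iIndepFun {Ω ι : Type*} [MeasurableSpace Ω] {P : Measure Ω}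
    [IsProbabilityMeasure P] [Fintype ι] {Y : ι → Ω → ℝ} (h : iIndepFun Y P)
    (hY : ∀ i, AEMeasurable (Y i) P) (hpos : ∀ i ω, 0 < Y i ω) :
    Integrable (fun ω => ∏ i, Y i ω) P ↔ ∀ i, Integrable (Y i) P := by
  have hprod : AEMeasurable (fun ω => ∏ i, Y i ω) P :=
    Finset.aemeasurable_fun_prod _ fun i _ => hY i
  rw [← lintegral_ofReal_ne_top_iff_integrable hprod.aestronglyMeasurable
    (Filter.Eventually.of_forall fun ω => Finset.prod_nonneg fun i _ => (hpos i ω).le)]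
  simp_rw [← fun i => lintegral_ofReal_ne_top_iff_integrable (hY i).aestronglyMeasurable
    (Filter.Eventually.of_forall fun ω => (hpos i ω).le),
    fun ω => ENNReal.ofReal_prod_of_nonneg fun i (_ : i ∈ Finset.univ) => (hpos i ω).le]
  have h' : iIndepFun (fun i ω => ENNReal.ofReal (Y i ω)) P :=
    h.comp (fun _ => ENNReal.ofReal) fun _ => ENNReal.measurable_ofReal
  rw [lintegral_prod_of_iIndepFun _ h' fun i => (hY i).ennreal_ofReal, Ne]
  have hne (i) : ∫⁻ ω, ENNReal.ofReal (Y i ω) ∂P ≠ 0 := by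
    rw [Ne, lintegral_eq_zero_iff' (hY i).ennreal_ofReal]
    intro h0
    obtain ⟨ω, hω⟩ := h0.exists
    exact (ENNReal.ofReal_pos.2 (hpos i ω)).ne' hω
  constructor
  · intro h0 i hi
    exact h0 (WithTop.prod_eq_top (Finset.mem_univ i) hi fun j _ => hne j)
  · exact fun h0 => ENNReal.prod_ne_top fun i _ => h0 i

/-! ### Signed combinations of probability measures -/

theorem charFun_add_sum_smul {ι : Type*} (s : Finset ι) (c : ι → ℝ) (hc : ∀ i, 0 ≤ c i)
    (ν : ι → Measure ℝ) [∀ i, IsProbabilityMeasure (ν i)] (μ : Measure ℝ) [IsFiniteMeasure μ]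
    (t : ℝ) :
    charFun (μ + ∑ i ∈ s, ENNReal.ofReal (c i) • ν i) t =
      charFun μ t + ∑ i ∈ s, c i * charFun (ν i) t := by
  have hint (ρ : Measure ℝ) [IsFiniteMeasure ρ] :
      Integrable (fun x : ℝ => Complex.exp (t * x * Complex.I)) ρ := by
    refine (integrable_const (1 : ℝ)).mono' (by fun_prop) (Filter.Eventually.of_forall fun x => ?_)
    rw [← Complex.ofReal_mul, Complex.norm_exp_ofReal_mul_I]
  have hs (i) : Integrable (fun x : ℝ => Complex.exp (t * x * Complex.I))
      (ENNReal.ofReal (c i) • ν i) := (hint (ν i)).smul_measure ENNReal.ofReal_ne_top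
  simp only [charFun_apply_real]
  rw [integral_add_measure (hint μ) (integrable_finsetSum_measure.2 fun i _ => hs i),
    integral_finsetSum_measure fun i _ => hs i]
  congr 1
  refine Finset.sum_congr rfl fun i _ => ?_
  rw [integral_smul_measure, ENNReal.toReal_ofReal (hc i), Complex.real_smul]

theorem measureReal_eq_sum_of_charFun {ι : Type*} (s : Finset ι) (c : ι → ℝ)
    (ν : ι → Measure ℝ) [∀ i, IsProbabilityMeasure (ν i)] (μ : Measure ℝ) [IsFiniteMeasure μ]
    (h : ∀ t, charFun μ t = ∑ i ∈ s, c i * charFun (ν i) t) (A : Set ℝ) :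
    μ.real A = ∑ i ∈ s, c i * (ν i).real A := by
  have hfin (c : ι → ℝ) : IsFiniteMeasure (∑ i ∈ s, ENNReal.ofReal (c i) • ν i) := by
    refine ⟨?_⟩
    rw [Measure.finsetSum_apply]
    exact ENNReal.sum_lt_top.2 fun i _ => ENNReal.mul_lt_top ENNReal.ofReal_lt_top (measure_lt_top _ _)
  have := hfin fun i => -c i ⊔ 0
  have := hfin fun i => c i ⊔ 0
  -- Split `c` into positive and negative parts so that both sides are genuine finite measures
  -- determined by their characteristic functions.
  have key : μ + ∑ i ∈ s, ENNReal.ofReal (-c i ⊔ 0) • ν i =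
      0 + ∑ i ∈ s, ENNReal.ofReal (c i ⊔ 0) • ν i := by
    refine Measure.ext_of_charFun (funext fun t => ?_)
    rw [charFun_add_sum_smul s _ (fun _ => le_sup_right),
      charFun_add_sum_smul s _ (fun _ => le_sup_right), h, charFun_zero_measure, zero_add,
      ← Finset.sum_add_distrib]
    refine Finset.sum_congr rfl fun i _ => ?_
    rw [← add_mul, ← Complex.ofReal_add]
    congr 2
    rcases le_total (c i) 0 with h0 | h0 <;> simp [h0]
  have h2 := congrArg (fun ρ : Measure ℝ => ρ.real A) key
  simp only [zero_add] at h2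
  rw [measureReal_add_apply] at h2
  have h3 (c : ι → ℝ) : (∑ i ∈ s, ENNReal.ofReal (c i ⊔ 0) • ν i).real A =
      ∑ i ∈ s, (c i ⊔ 0) * (ν i).real A := by
    rw [measureReal_def, Measure.finsetSum_apply, ENNReal.toReal_sum]
    · refine Finset.sum_congr rfl fun i _ => ?_
      simp [measureReal_def, ENNReal.toReal_ofReal']
    · intro i _
      exact ENNReal.mul_ne_top ENNReal.ofReal_ne_top (measure_ne_top _ _)
  rw [h3 (fun i => -c i), h3, ← eq_sub_iff_add_eq, ← Finset.sum_sub_distrib] at h2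
  rw [h2]
  refine Finset.sum_congr rfl fun i _ => ?_
  rw [← sub_mul]
  congr 1
  rcases le_total (c i) 0 with h0 | h0 <;> simp [h0]

/-- A signed combination of densities that represents a measure is its density. -/
theorem eq_withDensity_sum_of_measureReal {ι : Type*} (s : Finset ι) (c : ι → ℝ)
    (f : ι → ℝ → ℝ) (hf : ∀ i, Measurable (f i)) (hf0 : ∀ i x, 0 ≤ f i x)
    [∀ i, IsProbabilityMeasure (volume.withDensity fun x => ENNReal.ofReal (f i x))]
    (μ : Measure ℝ) [IsFiniteMeasure μ]
    (h : ∀ A, MeasurableSet A → μ.real A =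
      ∑ i ∈ s, c i * (volume.withDensity fun x => ENNReal.ofReal (f i x)).real A) :
    (∀ᵐ x, 0 ≤ ∑ i ∈ s, c i * f i x) ∧
      μ = volume.withDensity fun x => ENNReal.ofReal (∑ i ∈ s, c i * f i x) := by
  have hint (i) : Integrable (f i) := by
    rw [← lintegral_ofReal_ne_top_iff_integrable (hf i).aestronglyMeasurable
      (Filter.Eventually.of_forall (hf0 i)), ← setLIntegral_univ,
      ← withDensity_apply _ MeasurableSet.univ]
    exact measure_ne_top _ _
  have hg : Integrable fun x => ∑ i ∈ s, c i * f i x :=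
    integrable_finsetSum _ fun i _ => (hint i).const_mul _
  have hset (A : Set ℝ) (hA : MeasurableSet A) : ∫ x in A, ∑ i ∈ s, c i * f i x = μ.real A := by
    rw [h A hA, integral_finsetSum _ fun i _ => ((hint i).const_mul _).integrableOn]
    refine Finset.sum_congr rfl fun i _ => ?_
    rw [integral_const_mul, measureReal_def, withDensity_apply _ hA,
      integral_eq_lintegral_of_nonneg_ae (Filter.Eventually.of_forall (hf0 i))
        (hf i).aestronglyMeasurable]
  -- Its integral over each measurable set is a value of the positive measure `μ`.
  have hnn : ∀ᵐ x, 0 ≤ ∑ i ∈ s, c i * f i x :=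
    ae_nonneg_of_forall_setIntegral_nonneg hg fun A hA _ => by
      rw [hset A hA]
      exact measureReal_nonneg
  refine ⟨hnn, Measure.ext fun A hA => ?_⟩
  rw [withDensity_apply _ hA, ← ofReal_integral_eq_lintegral_ofReal hg.integrableOn
    (ae_restrict_of_ae hnn), hset A hA, ofReal_measureReal]

/-- The part of `U` where `g` is negative is open and Lebesgue null, hence empty. -/
theorem nonneg_of_ae_nonneg_of_continuousOn {g : ℝ → ℝ} {U : Set ℝ} (hU : IsOpen U)
    (hg : ContinuousOn g U) (h : ∀ᵐ x, 0 ≤ g x) {x : ℝ} (hx : x ∈ U) : 0 ≤ g x := by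
  by_contra! hlt
  have hopen : IsOpen (U ∩ g ⁻¹' Set.Iio 0) := hg.isOpen_inter_preimage hU isOpen_Iio
  have hnull : volume (U ∩ g ⁻¹' Set.Iio 0) = 0 :=
    measure_mono_null (fun y hy => not_le.2 hy.2) (ae_iff.1 h)
  rw [hopen.measure_eq_zero_iff volume] at hnull
  exact (Set.ext_iff.1 hnull x).1 ⟨hx, hlt⟩

/-! ### Moments and sums of log Pearson type III variables -/

theorem prod_logPearsonIIIMoment {N : ℕ} (a : Fin (N + 1) → ℕ) (b m : Fin (N + 1) → ℝ) (n : ℕ) :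
    ∏ i, logPearsonIIIMoment n (a i) (b i) (m i) =
      Real.exp ((∑ i, m i) * n) * ∏ i, (b i / (b i - n)) ^ a i := by
  simp only [logPearsonIIIMoment, Real.rpow_natCast]
  rw [Finset.prod_mul_distrib, ← Real.exp_sum, Finset.sum_mul]

theorem charFun_sum_pearsonIII {Ω : Type*} [MeasurableSpace Ω] {P : Measure Ω}
    [IsProbabilityMeasure P] {N : ℕ} {X : Fin (N + 1) → Ω → ℝ} {a : Fin (N + 1) → ℕ}
    {b m : Fin (N + 1) → ℝ} (ha : ∀ i, 0 < a i) (hb : ∀ i, b i ≠ 0)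
    (hX : ∀ i, HasLaw (X i) (pearsonIIIMeasure (a i) (b i) (m i)) P)
    (hindep : iIndepFun X P) (t : ℝ) :
    charFun (P.map fun ω => ∑ i, X i ω) t =
      (∏ i, ((b i : ℂ) / (b i - t * Complex.I)) ^ a i) *
        Complex.exp (t * (∑ i, m i : ℝ) * Complex.I) := by
  rw [iIndepFun.charFun_map_fun_sum_eq_prod (fun i => (hX i).aemeasurable) hindep,
    Finset.prod_apply]
  simp only [(hX _).map_eq, charFun_pearsonIIIMeasure (ha _) (hb _)]
  rw [Finset.prod_mul_distrib, ← Complex.exp_sum]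
  push_cast
  rw [Finset.mul_sum, Finset.sum_mul]

theorem ofReal_ne_ofReal_mul_I {b : ℝ} (hb : b ≠ 0) (t : ℝ) : (b : ℂ) ≠ t * Complex.I := fun h =>
  hb (by simpa using congrArg Complex.re h)

/-- The law of a sum of independent Pearson type III variables with equal rates. -/
theorem map_sum_pearsonIII_of_eq {Ω : Type*} [MeasurableSpace Ω] {P : Measure Ω}
    [IsProbabilityMeasure P] {N : ℕ} {X : Fin (N + 1) → Ω → ℝ} {a : Fin (N + 1) → ℕ}
    {b m : Fin (N + 1) → ℝ} (ha : ∀ i, 0 < a i) (hb : ∀ i, b i ≠ 0)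
    (hX : ∀ i, HasLaw (X i) (pearsonIIIMeasure (a i) (b i) (m i)) P)
    (hindep : iIndepFun X P) {b₀ : ℝ} (hb₀ : ∀ i, b i = b₀) :
    (P.map fun ω => ∑ i, X i ω) = pearsonIIIMeasure (∑ i, a i : ℕ) b₀ (∑ i, m i) := by
  have hsa : 0 < ∑ i, a i := Finset.sum_pos (fun i _ => ha i) Finset.univ_nonempty
  have hb0 : b₀ ≠ 0 := hb₀ 0 ▸ hb 0
  have := isProbabilityMeasure_pearsonIIIMeasure (Nat.cast_pos.2 hsa) hb0 (∑ i, m i)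
  refine Measure.ext_of_charFun (funext fun t => ?_)
  rw [charFun_sum_pearsonIII ha hb hX hindep, charFun_pearsonIIIMeasure hsa hb0]
  simp only [hb₀, Finset.prod_pow_eq_pow_sum]

/-- The pairs `(i, k)` with `k < a i`. -/
def univPairs {N : ℕ} (a : Fin (N + 1) → ℕ) : Finset (Fin (N + 1) × ℕ) :=
  Finset.univ.biUnion fun i => (Finset.range (a i)).map ⟨Prod.mk i, Prod.mk_right_injective i⟩

/-- The shift to `p.2 + 1` makes the shape positive for every pair, so the measures indexed by pairs
are probability measures without a membership condition. -/
theorem sum_sum_Icc_eq_sum {M : Type*} [AddCommMonoid M] {N : ℕ} {a : Fin (N + 1) → ℕ}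
    (F : Fin (N + 1) → ℕ → M) :
    ∑ i, ∑ k ∈ Finset.Icc 1 (a i), F i k = ∑ p ∈ univPairs a, F p.1 (p.2 + 1) := by
  rw [univPairs, Finset.sum_biUnion]
  · refine Finset.sum_congr rfl fun i _ => ?_
    have h : Finset.Icc 1 (a i) = Finset.Ico (0 + 1) (a i + 1) := by
      ext k
      rw [Finset.mem_Icc, Finset.mem_Ico, Nat.lt_succ_iff]
    rw [Finset.sum_map, Finset.range_eq_Ico, h]
    exact (Finset.sum_Ico_add' (F i) 0 (a i) 1).symm
  · intro i _ j _ hij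
    simp only [Function.onFun, Finset.disjoint_left, Finset.mem_map, not_exists, not_and]
    rintro _ ⟨k, _, rfl⟩ l _ h
    exact hij (congrArg Prod.fst h).symm

/-- The law of a sum of independent Pearson type III variables with distinct rates. -/
theorem map_sum_pearsonIII_real_of_injective {Ω : Type*} [MeasurableSpace Ω] {P : Measure Ω}
    [IsProbabilityMeasure P] {N : ℕ} {X : Fin (N + 1) → Ω → ℝ} {a : Fin (N + 1) → ℕ}
    {b m : Fin (N + 1) → ℝ} (ha : ∀ i, 0 < a i) (hb : ∀ i, b i ≠ 0)
    (hX : ∀ i, HasLaw (X i) (pearsonIIIMeasure (a i) (b i) (m i)) P)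
    (hindep : iIndepFun X P) (hinj : Function.Injective b) (A : Set ℝ) :
    (P.map fun ω => ∑ i, X i ω).real A = ∑ i, ∑ k ∈ Finset.Icc 1 (a i),
      Xi0 i k a b * (pearsonIIIMeasure k (b i) (∑ q, m q)).real A := by
  have (p : Fin (N + 1) × ℕ) : IsProbabilityMeasure
      (pearsonIIIMeasure (p.2 + 1 : ℕ) (b p.1) (∑ q, m q)) :=
    isProbabilityMeasure_pearsonIIIMeasure (Nat.cast_pos.2 p.2.succ_pos) (hb _) _
  rw [sum_sum_Icc_eq_sum]
  have hmeas : AEMeasurable (fun ω => ∑ i, X i ω) P :=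
    Finset.aemeasurable_fun_sum _ fun i _ => (hX i).aemeasurable
  have := Measure.isProbabilityMeasure_map hmeas
  refine measureReal_eq_sum_of_charFun (univPairs a) (fun p => Xi0 p.1 (p.2 + 1) a b)
    (fun p => pearsonIIIMeasure (p.2 + 1 : ℕ) (b p.1) (∑ q, m q)) _ (fun t => ?_) A
  rw [charFun_sum_pearsonIII ha hb hX hindep]
  have h := prod_div_sub_pow_eq_sum_Xi0 (K := ℂ) ha hb hinj
    (z := t * Complex.I) fun i => ofReal_ne_ofReal_mul_I (hb i) t
  simp only [Complex.coe_algebraMap] at h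
  rw [h, ← sum_sum_Icc_eq_sum (fun i k => (Xi0 i k a b : ℂ) *
    charFun (pearsonIIIMeasure k (b i) (∑ q, m q)) t), Finset.sum_mul]
  refine Finset.sum_congr rfl fun i _ => ?_
  rw [Finset.sum_mul]
  refine Finset.sum_congr rfl fun k hk => ?_
  rw [charFun_pearsonIIIMeasure (Finset.mem_Icc.1 hk).1 (hb i), mul_assoc]

theorem nonneg_sum_Xi0_mul_logPearsonIIIPDF_and_map_eq {Ω : Type*} [MeasurableSpace Ω]
    {P : Measure Ω} [IsProbabilityMeasure P] {N : ℕ} {X : Fin (N + 1) → Ω → ℝ}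
    {a : Fin (N + 1) → ℕ} {b m : Fin (N + 1) → ℝ} (ha : ∀ i, 0 < a i)
    (hb : (∀ i, 0 < b i) ∨ (∀ i, b i < 0))
    (hX : ∀ i, HasLaw (X i) (pearsonIIIMeasure (a i) (b i) (m i)) P)
    (hindep : iIndepFun X P) (hinj : Function.Injective b) :
    (∀ y, 0 ≤ ∑ i, ∑ k ∈ Finset.Icc 1 (a i),
      Xi0 i k a b * logPearsonIIIPDF k (b i) (∑ q, m q) y) ∧
    (P.map fun ω => ∑ i, X i ω).map Real.exp = volume.withDensity fun y => ENNReal.ofReal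
      (∑ i, ∑ k ∈ Finset.Icc 1 (a i), Xi0 i k a b * logPearsonIIIPDF k (b i) (∑ q, m q) y) := by
  have hb0 (i) : b i ≠ 0 := hb.elim (fun h => (h i).ne') fun h => (h i).ne
  have hmeas : AEMeasurable (fun ω => ∑ i, X i ω) P :=
    Finset.aemeasurable_fun_sum _ fun i _ => (hX i).aemeasurable
  have := Measure.isProbabilityMeasure_map hmeas
  have (p : Fin (N + 1) × ℕ) : IsProbabilityMeasure (volume.withDensity fun y =>
      ENNReal.ofReal (logPearsonIIIPDF (p.2 + 1 : ℕ) (b p.1) (∑ q, m q) y)) := by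
    have := isProbabilityMeasure_pearsonIIIMeasure (Nat.cast_pos.2 p.2.succ_pos) (hb0 p.1) (∑ q, m q)
    rw [← map_exp_pearsonIIIMeasure]
    exact Measure.isProbabilityMeasure_map Real.measurable_exp.aemeasurable
  have key := eq_withDensity_sum_of_measureReal (univPairs a) (fun p => Xi0 p.1 (p.2 + 1) a b)
    (fun p => logPearsonIIIPDF (p.2 + 1 : ℕ) (b p.1) (∑ q, m q))
    (fun p => measurable_logPearsonIIIPDF _ _ _)
    (fun p => logPearsonIIIPDF_nonneg (Nat.cast_pos.2 p.2.succ_pos) (hb0 p.1) _)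
    ((P.map fun ω => ∑ i, X i ω).map Real.exp) fun A hA => by
      rw [map_measureReal_apply Real.measurable_exp hA,
        map_sum_pearsonIII_real_of_injective ha hb0 hX hindep hinj, sum_sum_Icc_eq_sum]
      refine Finset.sum_congr rfl fun p _ => ?_
      rw [← map_exp_pearsonIIIMeasure, map_measureReal_apply Real.measurable_exp hA]
  simp only [← fun y => sum_sum_Icc_eq_sum (a := a) (fun i k => Xi0 i k a b *
    logPearsonIIIPDF k (b i) (∑ q, m q) y)] at key
  refine ⟨fun y => ?_, key.2⟩
  -- The rates share one sign and the terms one shift, so all densities live on the same open range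
  -- and are continuous there; off it every term is zero.
  have hrange (i) : logPearsonIIIRange (b i) (∑ q, m q) = logPearsonIIIRange (b 0) (∑ q, m q) := by
    unfold logPearsonIIIRange
    rcases hb with h | h
    · rw [if_pos (h i), if_pos (h 0)]
    · rw [if_neg (h i).not_gt, if_neg (h 0).not_gt]
  by_cases hy : y ∈ logPearsonIIIRange (b 0) (∑ q, m q)
  · refine nonneg_of_ae_nonneg_of_continuousOn (isOpen_logPearsonIIIRange _ _) ?_ key.1 hy
    refine continuousOn_finsetSum _ fun i _ => continuousOn_finsetSum _ fun k _ =>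
      continuousOn_const.mul ?_
    rw [← hrange i]
    exact continuousOn_logPearsonIIIPDF (hb0 i) _
  · refine (Finset.sum_eq_zero fun i _ => Finset.sum_eq_zero fun k _ => ?_).ge
    rw [logPearsonIIIPDF, Set.indicator_of_notMem (hrange i ▸ hy), mul_zero]

theorem mainTheorem12 {Ω : Type*} [MeasurableSpace Ω] (P : Measure Ω) [IsProbabilityMeasure P]
    (N : ℕ) (X : Fin (N + 1) → Ω → ℝ) (a : Fin (N + 1) → ℕ) (b m : Fin (N + 1) → ℝ)
    (ha : ∀ i, 0 < a i)
    (hb : (∀ i, 0 < b i) ∨ (∀ i, b i < 0))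
    (hX : ∀ i, HasLaw (X i) (pearsonIIIMeasure (a i) (b i) (m i)) P)
    (hindep : iIndepFun X P)
    (SY : Ω → ℝ) (hSY : ∀ ω, SY ω = Real.exp (∑ i, X i ω)) :
    -- the moment of order `n` is finite for all `n` if the rates are negative,
    -- and exactly when every `b i` exceeds `n` if the rates are positive
    (∀ n : ℕ, Integrable (SY ^ n) P ↔ (∀ i, b i < 0) ∨ (∀ i, (n : ℝ) < b i)) ∧
    -- equal rates
    (∀ b₀ : ℝ, (∀ i, b i = b₀) →
      (∀ y, cdf (P.map SY) y = logPearsonIIICDF (∑ i, a i : ℕ) b₀ (∑ i, m i) y) ∧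
      IsDensityOf (logPearsonIIIPDF (∑ i, a i : ℕ) b₀ (∑ i, m i)) SY P ∧
      (∀ n : ℕ, (b₀ < 0 ∨ (n : ℝ) < b₀) →
        moment SY n P = logPearsonIIIMoment n (∑ i, a i : ℕ) b₀ (∑ i, m i))) ∧
    -- pairwise distinct rates
    ((∀ i j, i ≠ j → b i ≠ b j) →
      (∀ y, cdf (P.map SY) y =
        ∑ i, ∑ k ∈ Finset.Icc 1 (a i),
          Xi0 i k a b * logPearsonIIICDF k (b i) (∑ q, m q) y) ∧
      IsDensityOf
        (fun y => ∑ i, ∑ k ∈ Finset.Icc 1 (a i),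
          Xi0 i k a b * logPearsonIIIPDF k (b i) (∑ q, m q) y) SY P ∧
      (∀ n : ℕ, ((∀ i, b i < 0) ∨ (∀ i, (n : ℝ) < b i)) →
        moment SY n P =
          ∑ i, ∑ k ∈ Finset.Icc 1 (a i),
            Xi0 i k a b * logPearsonIIIMoment n k (b i) (∑ q, m q))) := by
  have hb0 (i) : b i ≠ 0 := hb.elim (fun h => (h i).ne') fun h => (h i).ne
  have hmeas : AEMeasurable (fun ω => ∑ i, X i ω) P :=
    Finset.aemeasurable_fun_sum _ fun i _ => (hX i).aemeasurable
  obtain rfl : SY = fun ω => Real.exp (∑ i, X i ω) := funext hSY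
  have hmap : (P.map fun ω => Real.exp (∑ i, X i ω)) =
      (P.map fun ω => ∑ i, X i ω).map Real.exp :=
    (AEMeasurable.map_map_of_aemeasurable Real.measurable_exp.aemeasurable hmeas).symm
  have hcdf (y : ℝ) : cdf (P.map fun ω => Real.exp (∑ i, X i ω)) y =
      (P.map fun ω => ∑ i, X i ω).real (Real.exp ⁻¹' Set.Iic y) := by
    have := Measure.isProbabilityMeasure_map hmeas.exp
    rw [cdf_eq_real, hmap, map_measureReal_apply Real.measurable_exp measurableSet_Iic]
  have hindep' (n : ℕ) : iIndepFun (fun i ω => Real.exp (n * X i ω)) P :=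
    hindep.comp (fun _ x => Real.exp (n * x)) fun _ => by fun_prop
  have hmeas' (n : ℕ) (i) : AEMeasurable (fun ω => Real.exp (n * X i ω)) P :=
    ((hX i).aemeasurable.const_mul _).exp
  have hpow (n : ℕ) : (fun ω => Real.exp (∑ i, X i ω)) ^ n =
      fun ω => ∏ i, Real.exp (n * X i ω) := by
    ext ω
    rw [Pi.pow_apply, ← Real.exp_nat_mul, Finset.mul_sum, Real.exp_sum]
  have hmoment (n : ℕ) (hn : ∀ i, b i < 0 ∨ (n : ℝ) < b i) :
      moment (fun ω => Real.exp (∑ i, X i ω)) n P =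
        Real.exp ((∑ i, m i) * n) * ∏ i, (b i / (b i - n)) ^ a i := by
    rw [moment_def, hpow, iIndepFun.integral_fun_prod_eq_prod_integral (hindep' n)
      fun i => (hmeas' n i).aestronglyMeasurable, ← prod_logPearsonIIIMoment]
    refine Finset.prod_congr rfl fun i _ => ?_
    rw [← integral_exp_pearsonIIIMeasure (Nat.cast_pos.2 (ha i)) (hb0 i) _ (hn i), ← (hX i).map_eq,
      integral_map (hX i).aemeasurable (by fun_prop)]
  refine ⟨fun n => ?_, fun b₀ hb₀ => ?_, fun hne => ?_⟩
  · rw [hpow, integrable_prod_iff_of_iIndepFun (hindep' n) (hmeas' n) fun _ _ => Real.exp_pos _]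
    have h (i) : Integrable (fun ω => Real.exp (n * X i ω)) P ↔ b i < 0 ∨ (n : ℝ) < b i := by
      rw [← integrable_exp_pearsonIIIMeasure_iff (Nat.cast_pos.2 (ha i)) (hb0 i) (m i),
        ← (hX i).map_eq, integrable_map_measure (by fun_prop) (hX i).aemeasurable]
      rfl
    simp_rw [h]
    rcases hb with hb | hb
    · simp [fun i => (hb i).not_gt]
    · simp [hb]
  · have hsa : 0 < ∑ i, a i := Finset.sum_pos (fun i _ => ha i) Finset.univ_nonempty
    have hsa' : (0 : ℝ) < (∑ i, a i : ℕ) := Nat.cast_pos.2 hsa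
    have hb₀0 : b₀ ≠ 0 := hb₀ 0 ▸ hb0 0
    have hlaw := map_sum_pearsonIII_of_eq ha hb0 hX hindep hb₀
    refine ⟨fun y => ?_, ⟨measurable_logPearsonIIIPDF _ _ _, logPearsonIIIPDF_nonneg hsa' hb₀0 _,
      ⟨hmeas.exp, ?_⟩⟩, fun n hn => ?_⟩
    · rw [hcdf, hlaw, pearsonIIIMeasure_real_exp_preimage_Iic hsa' hb₀0]
    · rw [hmap, hlaw, map_exp_pearsonIIIMeasure]
    · rw [hmoment n fun i => by rwa [hb₀ i], logPearsonIIIMoment, Real.rpow_natCast]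
      simp only [hb₀, Finset.prod_pow_eq_pow_sum]
  · have hinj : Function.Injective b := fun i j h => by_contra fun hij => hne i j hij h
    have hdens := nonneg_sum_Xi0_mul_logPearsonIIIPDF_and_map_eq ha hb hX hindep hinj
    refine ⟨fun y => ?_, ⟨?_, hdens.1, ⟨hmeas.exp, hmap.trans hdens.2⟩⟩, fun n hn => ?_⟩
    · rw [hcdf, map_sum_pearsonIII_real_of_injective ha hb0 hX hindep hinj]
      refine Finset.sum_congr rfl fun i _ => Finset.sum_congr rfl fun k hk => ?_
      rw [pearsonIIIMeasure_real_exp_preimage_Iic (Nat.cast_pos.2 (Finset.mem_Icc.1 hk).1) (hb0 i)]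
    · exact Finset.measurable_fun_sum _ fun i _ => Finset.measurable_fun_sum _ fun k _ =>
        (measurable_logPearsonIIIPDF _ _ _).const_mul _
    -- The moment condition keeps `n` away from the poles, so the partial fraction identity can be
    -- evaluated at `z = n`.
    · have hz (i) : b i ≠ n := hn.elim (fun h => ((h i).trans_le n.cast_nonneg).ne)
        fun h => (h i).ne'
      have h := prod_div_sub_pow_eq_sum_Xi0 (K := ℝ) ha hb0 hinj hz
      simp only [Algebra.algebraMap_self, RingHom.id_apply] at h
      rw [hmoment n fun i => hn.imp (fun h => h i) fun h => h i, h, Finset.mul_sum]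
      refine Finset.sum_congr rfl fun i _ => ?_
      rw [Finset.mul_sum]
      refine Finset.sum_congr rfl fun k _ => ?_
      rw [logPearsonIIIMoment, Real.rpow_natCast]
      ring
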